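/- Let $N\ge 3$ be an integer, $0<k\le 2$ and $\gamma\in\mathbb{R}$. Let $f:\mathbb{R}\to\mathbb{R}$ satisfy $(f_1)$ $f\in C^2[0,\infty)$ and $f>0$ on $[0,\infty)$; $(f_2)$ $F(u):=\int_u^\infty \frac{ds}{f(s)}<\infty$ for $u\ge 0$, and the limit $q:=\lim_{u\to\infty}\frac{f'(u)^2}{f(u)f''(u)}$ exists and satisfies $q<\frac{N+2}{4}$; $(F_1)$ $\bigl(F(u)f'(u)-q_{\mathrm{JL}}\bigr)(-\log F(u))^k\to\gamma$ as $u\to\infty$, where $q_{\mathrm{JL}}:=\frac{N-2\sqrt{N-1}}{4}$. Let $V$ be a radial singular solution of $-\Delta V=f(V)$, that is, $V\in C^2(0,\infty)$, $V''(r)+\frac{N-1}{r}V'(r)+f(V(r))=0$ for all $r>0$, and $V(r)\to\infty$ as $r\to 0$. Then $$f'(V(r))=\frac{(N-2)^2}{4r^2}+\frac{\gamma\sqrt{N-1}+o(1)}{2^{k-2}r^2(-\log r)^k}\qquad\text{as } r\to 0.$$ -/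

import Mathlib

open Set Filter Topology MeasureTheory

noncomputable section

/-- Smoothness and positivity: `f ∈ C²[0, ∞)` and `f > 0` on `[0, ∞)`. -/
structure CondSmoothPos (f : ℝ → ℝ) : Prop where
  contDiffOn : ContDiffOn ℝ 2 f (Ici 0)
  pos : ∀ u, 0 ≤ u → 0 < f u

/-- `F(u) = ∫_u^∞ ds / f(s)`. -/
def tailIntegral (f : ℝ → ℝ) (u : ℝ) : ℝ := ∫ s in Ioi u, 1 / f s

/-- Supercritical growth: the integral `F` is finite, and the limit
`q = lim_{u → ∞} f'(u)² / (f(u) f''(u))` exists and satisfies `q < (N + 2) / 4`.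
The clause `f'' ≠ 0` near infinity says that the quotient is defined there. -/
structure CondSupercritical (N : ℕ) (f : ℝ → ℝ) : Prop where
  integrable : IntegrableOn (fun s => 1 / f s) (Ioi 0)
  second_deriv_ne_zero : ∀ᶠ u in atTop, deriv (deriv f) u ≠ 0
  limit : ∃ q : ℝ,
    Tendsto (fun u => (deriv f u) ^ 2 / (f u * deriv (deriv f) u)) atTop (𝓝 q) ∧
      q < ((N : ℝ) + 2) / 4

/-- The Joseph-Lundgren value `q_JL = (N - 2 √(N - 1)) / 4`. -/
def qJL (N : ℕ) : ℝ := ((N : ℝ) - 2 * √((N : ℝ) - 1)) / 4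

/-- Refined asymptotics at infinity: `(F(u) f'(u) - q_JL) (-log F(u))^k → γ` as `u → ∞`. -/
def CondRefined (N : ℕ) (f : ℝ → ℝ) (k γ : ℝ) : Prop :=
  Tendsto
    (fun u => (tailIntegral f u * deriv f u - qJL N) * (-Real.log (tailIntegral f u)) ^ k)
    atTop (𝓝 γ)

/-- The Laplacian in `ℝ^N` of the radial function with profile `V`, at radius `r > 0`. -/
def radialLaplacian (N : ℕ) (V : ℝ → ℝ) (r : ℝ) : ℝ :=
  deriv (deriv V) r + ((N : ℝ) - 1) / r * deriv V r

/-- `V ∈ C²(0, ∞)` is a radial singular solution of `-ΔV = f(V)` in `(0, ∞)`. -/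
structure IsRadialSingularSolution (N : ℕ) (f V : ℝ → ℝ) : Prop where
  contDiffOn : ContDiffOn ℝ 2 V (Ioi 0)
  equation : ∀ r, 0 < r → -radialLaplacian N V r = f (V r)
  singular : Tendsto V (𝓝[>] 0) atTop

end

/-! Put `t = -log r`, `l = √(N-1) + 1`, `s(t) = l² e^{2t} F(V(e^{-t}))`, `u = s - 1`, `v = u'` and
`Q = F(V) f'(V)`. At the Joseph-Lundgren value `q_JL = (l-2)²/4` the equation for `u` linearises to
`u'' - 2l u' + l² u = 0`, with the double root `l > 0`: the origin is an unstable node. A solution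
that does not blow up at the unstable rate must therefore tend to the origin, and it follows the
slowly varying forcing quasi-statically.

The a priori bounds are `s > 0`, `2s - v > 0` (this is `V' < 0`) and `s = o(e^{2t})` (this is `F(V)
→ 0`). They exclude growth, so `u, v → 0` (`tendsto_zero`, `tendsto_deriv_zero`). Then `-log F(V) ~
2t` turns the refined hypothesis into `t^k (Q - q_JL) → γ / 2^k`, and the balance `l² u ≈ 4(Q -
q_JL)` gives the limit of `t^k u` (`tendsto_rpow_mul`). Finally `f'(V) = l² Q / (r² s)` is expanded
to first order. -/

/-! ### Differential inequalities on a half-line -/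

/-- `(R - d/c) e^{-ct}` is nondecreasing, and its majorant tends to `0`. The separate majorant `U`
allows an unbounded `R` that grows more slowly than `e^{ct}`. -/
theorem le_div_of_mul_sub_le_deriv {R R' U : ℝ → ℝ} {c d T : ℝ} (hc : 0 < c)
    (hR : ∀ t, T ≤ t → HasDerivAt R (R' t) t)
    (h : ∀ t, T ≤ t → c * R t - d ≤ R' t) (hU : ∀ t, T ≤ t → R t ≤ U t)
    (hlim : Tendsto (fun t => U t * Real.exp (-c * t)) atTop (𝓝 0)) :
    ∀ t, T ≤ t → R t ≤ d / c := by
  have hexp : ∀ t, HasDerivAt (fun t => Real.exp (-c * t)) (Real.exp (-c * t) * (-c)) t := by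
    intro t
    simpa using ((hasDerivAt_id t).const_mul (-c)).exp
  have hG : ∀ t, T ≤ t → HasDerivAt (fun t => (R t - d / c) * Real.exp (-c * t))
      (R' t * Real.exp (-c * t) + (R t - d / c) * (Real.exp (-c * t) * (-c))) t := by
    intro t ht
    exact ((hR t ht).sub_const _).mul (hexp t)
  have hmono : MonotoneOn (fun t => (R t - d / c) * Real.exp (-c * t)) (Ici T) := by
    apply monotoneOn_of_deriv_nonneg (convex_Ici T)
    · intro t ht
      exact (hG t ht).continuousAt.continuousWithinAt
    · intro t ht
      rw [interior_Ici] at ht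
      exact (hG t ht.le).differentiableAt.differentiableWithinAt
    · intro t ht
      rw [interior_Ici] at ht
      rw [(hG t ht.le).deriv]
      have h1 := h t ht.le
      have h2 : R' t * Real.exp (-c * t) + (R t - d / c) * (Real.exp (-c * t) * (-c))
          = (R' t - (c * R t - d)) * Real.exp (-c * t) := by field_simp; ring
      rw [h2]
      exact mul_nonneg (by linarith) (Real.exp_pos _).le
  have hexp0 : Tendsto (fun t => Real.exp (-c * t)) atTop (𝓝 0) :=
    Real.tendsto_exp_atBot.comp (tendsto_id.const_mul_atTop_of_neg (by linarith))
  have hlim' : Tendsto (fun t => (U t - d / c) * Real.exp (-c * t)) atTop (𝓝 0) := by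
    have := hlim.sub (hexp0.const_mul (d / c))
    simp only [mul_zero, sub_zero] at this
    refine this.congr fun t => by ring
  intro t ht
  have h0 : (R t - d / c) * Real.exp (-c * t) ≤ 0 := by
    refine ge_of_tendsto hlim' ?_
    filter_upwards [eventually_ge_atTop t] with x hx
    refine (hmono ht (ht.trans hx : T ≤ x) hx).trans ?_
    exact mul_le_mul_of_nonneg_right (by linarith [hU x (ht.trans hx)]) (Real.exp_pos _).le
  have := nonpos_of_mul_nonpos_left h0 (Real.exp_pos _)
  linarith

theorem le_div_of_mul_sub_le_deriv_of_le {R R' : ℝ → ℝ} {c d T M : ℝ} (hc : 0 < c)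
    (hR : ∀ t, T ≤ t → HasDerivAt R (R' t) t)
    (h : ∀ t, T ≤ t → c * R t - d ≤ R' t) (hM : ∀ t, T ≤ t → R t ≤ M) :
    ∀ t, T ≤ t → R t ≤ d / c := by
  refine le_div_of_mul_sub_le_deriv (U := fun _ => M) hc hR h hM ?_
  have hexp0 : Tendsto (fun t => Real.exp (-c * t)) atTop (𝓝 0) :=
    Real.tendsto_exp_atBot.comp (tendsto_id.const_mul_atTop_of_neg (by linarith))
  simpa using hexp0.const_mul M

theorem nonpos_of_deriv_neg_of_eq_zero {g g' : ℝ → ℝ} {a b : ℝ}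
    (hg : ∀ t, a ≤ t → HasDerivAt g (g' t) t) (ha : g a ≤ 0)
    (h : ∀ t, a ≤ t → t < b → g t = 0 → g' t < 0) : ∀ t, a ≤ t → t ≤ b → g t ≤ 0 := by
  intro t h1 h2
  exact image_le_of_deriv_right_lt_deriv_boundary' (f := g) (f' := g') (a := a) (b := b)
    (B := fun _ => 0) (B' := fun _ => 0)
    (fun x hx => (hg x hx.1).continuousAt.continuousWithinAt)
    (fun x hx => (hg x hx.1).hasDerivWithinAt) ha continuousOn_const
    (fun x _ => hasDerivWithinAt_const _ _ _) (fun x hx => h x hx.1 hx.2) ⟨h1, h2⟩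

theorem sub_le_mul_of_deriv_le {g g' : ℝ → ℝ} {a b C : ℝ} (hab : a ≤ b)
    (hg : ∀ t, a ≤ t → HasDerivAt g (g' t) t)
    (h : ∀ t, a ≤ t → t ≤ b → g' t ≤ C) : g b - g a ≤ C * (b - a) := by
  refine (convex_Icc a b).image_sub_le_mul_sub_of_deriv_le
    (fun x hx => (hg x hx.1).continuousAt.continuousWithinAt) ?_ ?_
    a (left_mem_Icc.2 hab) b (right_mem_Icc.2 hab) hab
  · intro x hx
    rw [interior_Icc] at hx
    exact (hg x hx.1.le).differentiableAt.differentiableWithinAt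
  · intro x hx
    rw [interior_Icc] at hx
    rw [(hg x hx.1.le).deriv]
    exact h x hx.1.le hx.2.le

/-! ### Convergence of the perturbed node to the origin -/

/-- A planar system, asymptotically autonomous as `t → ∞`, whose limit system has an unstable
node with the double eigenvalue `l` at the origin. -/
structure IsPerturbedNode (l : ℝ) (u v Q : ℝ → ℝ) (T : ℝ) : Prop where
  two_lt : 2 < l
  hasDerivAt_u : ∀ t, T ≤ t → HasDerivAt u (v t) t
  hasDerivAt_v : ∀ t, T ≤ t → HasDerivAt v (2 * l * v t - l ^ 2 * u t +
    ((l - 2) ^ 2 / 4 * v t ^ 2 + (Q t - (l - 2) ^ 2 / 4) * (2 * (1 + u t) - v t) ^ 2)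
      / (1 + u t)) t
  one_add_pos : ∀ t, T ≤ t → 0 < 1 + u t
  two_mul_sub_pos : ∀ t, T ≤ t → 0 < 2 * (1 + u t) - v t
  tendsto_Q : Tendsto Q atTop (𝓝 ((l - 2) ^ 2 / 4))
  tendsto_exp : Tendsto (fun t => (1 + u t) * Real.exp (-2 * t)) atTop (𝓝 0)

namespace IsPerturbedNode

variable {l : ℝ} {u v Q : ℝ → ℝ} {T : ℝ}

theorem eventually_abs_Q (h : IsPerturbedNode l u v Q T) {e : ℝ} (he : 0 < e) :
    ∀ᶠ t in atTop, |Q t - (l - 2) ^ 2 / 4| ≤ e := by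
  have := (tendsto_sub_nhds_zero_iff.2 h.tendsto_Q).abs
  rw [abs_zero] at this
  exact this.eventually_le_const he

/-- `w = v - l u` satisfies `w' ≥ l w` up to a small error, and the bounds on `s` and `2s - v` give
`w < l`, so `w` cannot stay away from `0` on the positive side. -/
theorem eventually_sub_le (h : IsPerturbedNode l u v Q T) {e : ℝ} (he : 0 < e) :
    ∀ᶠ t in atTop, v t - l * u t ≤ e := by
  have hl := h.two_lt
  set K := 1 + 1 / (l - 2) with hK
  have hl2 : 0 < l - 2 := by linarith
  have hKpos : 0 < K := by positivity
  have hKl : 1 ≤ K * (l - 2) := by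
    have : K * (l - 2) = (l - 2) + 1 := by rw [hK]; field_simp
    linarith
  have hK1 : 1 ≤ K := by
    have : 0 < 1 / (l - 2) := by positivity
    linarith
  have hq : 0 < (l - 2) ^ 2 / 4 := by positivity
  have hd : 0 < e / (4 * l * K) := by positivity
  obtain ⟨T', hT'⟩ := ((h.eventually_abs_Q hd).and ((h.tendsto_Q.eventually_const_lt hq).and
    (eventually_ge_atTop T))).exists_forall_of_atTop
  -- With `A = 2s - v` one has `A + (l-2)s = l - w`. The error is at least `-(e/l)(l - w) = (e/l) w
  -- - e`, whence `c = l + e/l` and `d = e`.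
  have hmain := le_div_of_mul_sub_le_deriv_of_le (R := fun t => v t - l * u t)
    (R' := fun t => (2 * l * v t - l ^ 2 * u t +
    ((l - 2) ^ 2 / 4 * v t ^ 2 + (Q t - (l - 2) ^ 2 / 4) * (2 * (1 + u t) - v t) ^ 2)
      / (1 + u t)) - l * v t) (c := l + e / l) (d := e) (T := T') (M := l) (by positivity)
    (fun t ht => (h.hasDerivAt_v t (hT' t ht).2.2).sub
      ((h.hasDerivAt_u t (hT' t ht).2.2).const_mul l)) ?_ ?_
  · filter_upwards [eventually_ge_atTop T'] with t ht
    refine (hmain t ht).trans ?_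
    rw [div_le_iff₀ (by positivity)]
    have : 0 < e / l := by positivity
    nlinarith
  · intro t ht
    obtain ⟨h1, h2, h3⟩ := hT' t ht
    have hs := h.one_add_pos t h3
    have hA := h.two_mul_sub_pos t h3
    set s := 1 + u t with hsdef
    set A := 2 * s - v t with hAdef
    have hu : u t = s - 1 := by rw [hsdef]; ring
    have hv : v t = 2 * s - A := by rw [hAdef]; ring
    set q := (l - 2) ^ 2 / 4 with hqdef
    have e1 : (q * v t ^ 2 + (Q t - q) * A ^ 2) / s
        = 4 * (Q t - q) * (A - s) + Q t * (A - 2 * s) ^ 2 / s := by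
      rw [hv]; field_simp; ring
    have e2 : 0 ≤ Q t * (A - 2 * s) ^ 2 / s := by positivity
    have e3 : -(4 * (e / (4 * l * K)) * (A + s)) ≤ 4 * (Q t - q) * (A - s) := by
      have : |(Q t - q) * (A - s)| ≤ e / (4 * l * K) * (A + s) := by
        rw [abs_mul]
        refine mul_le_mul h1 ?_ (abs_nonneg _) hd.le
        rw [abs_le]; constructor <;> linarith
      have := (abs_le.1 this).1
      linarith
    have e4 : A + s ≤ K * (A + (l - 2) * s) := by nlinarith
    have e5 : 4 * (e / (4 * l * K)) * (A + s) ≤ e / l * (A + (l - 2) * s) := by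
      calc 4 * (e / (4 * l * K)) * (A + s)
          ≤ 4 * (e / (4 * l * K)) * (K * (A + (l - 2) * s)) := by gcongr
        _ = _ := by field_simp
    have e6 : A + (l - 2) * s = l - (v t - l * u t) := by rw [hu, hv]; ring
    rw [e6] at e5
    have e7 : e / l * l = e := by field_simp
    rw [e1]
    nlinarith
  · intro t ht
    obtain ⟨h1, h2, h3⟩ := hT' t ht
    have hs := h.one_add_pos t h3
    have hA := h.two_mul_sub_pos t h3
    nlinarith

theorem eventually_neg_le (h : IsPerturbedNode l u v Q T) {e : ℝ} (he : 0 < e) :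
    ∀ᶠ t in atTop, -e ≤ u t := by
  have hl := h.two_lt
  obtain ⟨T', hT'⟩ := ((h.eventually_sub_le he).and
    (eventually_ge_atTop T)).exists_forall_of_atTop
  have hmain := le_div_of_mul_sub_le_deriv_of_le (R := fun t => -u t)
    (R' := fun t => -v t) (c := l) (d := e) (T := T') (M := 1) (by positivity)
    (fun t ht => (h.hasDerivAt_u t (hT' t ht).2).neg) ?_ ?_
  · filter_upwards [eventually_ge_atTop T'] with t ht
    have h1 : e / l ≤ e := by rw [div_le_iff₀ (by positivity)]; nlinarith
    have := hmain t ht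
    linarith
  · intro t ht
    have := (hT' t ht).1
    linarith
  · intro t ht
    have := h.one_add_pos t (hT' t ht).2
    linarith

/-- Below a small negative level `v` is trapped, because there `v' < 0` on the level itself. Then
`u` decreases at least linearly and reaches `-1` in finite time, which is excluded. -/
theorem eventually_neg_le_deriv (h : IsPerturbedNode l u v Q T) {e : ℝ} (he : 0 < e) :
    ∀ᶠ t in atTop, -e ≤ v t := by
  have hl := h.two_lt
  set q := (l - 2) ^ 2 / 4 with hqdef
  have hq : 0 < q := by have : 0 < l - 2 := by linarith
                        positivity
  obtain ⟨p, hp, hpe, hp1, hpq⟩ : ∃ p : ℝ, 0 < p ∧ p ≤ e ∧ p ≤ 1 ∧ q * p ≤ 1 := by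
    refine ⟨min e (min 1 (1 / q)), by positivity, min_le_left _ _,
      (min_le_right _ _).trans (min_le_left _ _), ?_⟩
    have : min e (min 1 (1 / q)) ≤ 1 / q := (min_le_right _ _).trans (min_le_right _ _)
    calc q * _ ≤ q * (1 / q) := by gcongr
      _ = 1 := by field_simp
  obtain ⟨d, hd, hd1, hd2⟩ : ∃ d : ℝ, 0 < d ∧ d ≤ 1 / 2 ∧ (l ^ 2 + 10) * d ≤ p / 2 := by
    refine ⟨min (1 / 2) (p / 2 / (l ^ 2 + 10)), by positivity, min_le_left _ _, ?_⟩
    calc (l ^ 2 + 10) * _ ≤ (l ^ 2 + 10) * (p / 2 / (l ^ 2 + 10)) := by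
          gcongr; exact min_le_right _ _
      _ = p / 2 := by field_simp
  obtain ⟨T', hT'⟩ := ((h.eventually_abs_Q hd).and ((h.eventually_neg_le hd).and
    (eventually_ge_atTop T))).exists_forall_of_atTop
  filter_upwards [eventually_ge_atTop T'] with t ht
  by_contra! hneg
  have hstay : ∀ x, t ≤ x → v x + p ≤ 0 := by
    intro x hx
    refine nonpos_of_deriv_neg_of_eq_zero (b := x) (g := fun x => v x + p)
      (fun y hy => (h.hasDerivAt_v y (hT' y (ht.trans hy)).2.2).add_const p) (by linarith) ?_ x hx
      le_rfl
    intro y hy _ hy0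
    obtain ⟨h1, h2, h3⟩ := hT' y (ht.trans hy)
    have hv : v y = -p := by linarith
    rw [hv]
    have hs := h.one_add_pos y h3
    have hs2 : 1 / 2 ≤ 1 + u y := by linarith
    have k1 : q * (-p) ^ 2 / (1 + u y) ≤ 2 * p := by
      rw [div_le_iff₀ hs]; nlinarith
    have k2 : (Q y - q) * (2 * (1 + u y) - -p) ^ 2 / (1 + u y) ≤ d * (4 * u y + 10) := by
      rw [div_le_iff₀ hs]
      have : (2 * (1 + u y) - -p) ^ 2 ≤ (4 * u y + 10) * (1 + u y) := by nlinarith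
      calc _ ≤ d * (2 * (1 + u y) - -p) ^ 2 := by
            gcongr; exact (le_abs_self _).trans h1
        _ ≤ d * ((4 * u y + 10) * (1 + u y)) := by gcongr
        _ = _ := by ring
    rw [add_div]
    have k3 : 0 ≤ (l ^ 2 - 4 * d) * (u y + d) := mul_nonneg (by nlinarith) (by linarith)
    nlinarith
  have hlin := sub_le_mul_of_deriv_le (g := u) (g' := v) (a := t) (b := t + (u t + 1) / p)
    (C := -p) (by have := h.one_add_pos t (hT' t ht).2.2
                  have : 0 < (u t + 1) / p := div_pos (by linarith) hp
                  linarith)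
    (fun y hy => h.hasDerivAt_u y (hT' y (ht.trans hy)).2.2)
    (fun y hy _ => by linarith [hstay y hy])
  have h4 := h.one_add_pos t (hT' t ht).2.2
  have h5 : 0 < (u t + 1) / p := div_pos (by linarith) hp
  have h6 := h.one_add_pos (t + (u t + 1) / p) (hT' _ (by linarith)).2.2
  have h7 : -p * (t + (u t + 1) / p - t) = -(u t + 1) := by field_simp; ring
  linarith

/-- If `v ≤ 0` while `u ≥ 2e`, then `u ≥ e` during the next unit of time, since `v ≥ -p`. The term
`-l² u` keeps `v' ≤ -e` there, so `v` falls below `-p`. -/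
theorem eventually_deriv_pos_of_le (h : IsPerturbedNode l u v Q T) {e : ℝ} (he : 0 < e) :
    ∀ᶠ t in atTop, 2 * e ≤ u t → 0 < v t := by
  have hl := h.two_lt
  set q := (l - 2) ^ 2 / 4 with hqdef
  have hq : 0 < q := by have : 0 < l - 2 := by linarith
                        positivity
  obtain ⟨p, hp, hpe, hp1, hpq⟩ : ∃ p : ℝ, 0 < p ∧ p ≤ e / 2 ∧ p ≤ 1 ∧ q * p ≤ e := by
    refine ⟨min (e / 2) (min 1 (e / q)), by positivity, min_le_left _ _,
      (min_le_right _ _).trans (min_le_left _ _), ?_⟩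
    have : min (e / 2) (min 1 (e / q)) ≤ e / q := (min_le_right _ _).trans (min_le_right _ _)
    calc q * _ ≤ q * (e / q) := by gcongr
      _ = e := by field_simp
  obtain ⟨d, hd, hd1, hd2⟩ : ∃ d : ℝ, 0 < d ∧ d ≤ 1 / 4 ∧ d ≤ e / 10 :=
    ⟨min (1 / 4) (e / 10), by positivity, min_le_left _ _, min_le_right _ _⟩
  obtain ⟨T', hT'⟩ := ((h.eventually_abs_Q hd).and ((h.eventually_neg_le_deriv hp).and
    (eventually_ge_atTop T))).exists_forall_of_atTop
  filter_upwards [eventually_ge_atTop T'] with t ht hut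
  by_contra! hneg
  have hu : ∀ x, t ≤ x → x ≤ t + 1 → e ≤ u x := by
    intro x hx hx1
    have := sub_le_mul_of_deriv_le (g := fun y => -u y) (g' := fun y => -v y) (a := t) (b := x)
      (C := p) hx (fun y hy => (h.hasDerivAt_u y (hT' y (ht.trans hy)).2.2).neg)
      (fun y hy _ => by linarith [(hT' y (ht.trans hy)).2.1])
    nlinarith
  have hder : ∀ y, t ≤ y → y ≤ t + 1 → v y ≤ 0 → 2 * l * v y - l ^ 2 * u y +
      (q * v y ^ 2 + (Q y - q) * (2 * (1 + u y) - v y) ^ 2) / (1 + u y) ≤ -e := by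
    intro y hy hy1 hv
    obtain ⟨h1, h2, h3⟩ := hT' y (ht.trans hy)
    have hs := h.one_add_pos y h3
    have hue := hu y hy hy1
    have k1 : q * (v y) ^ 2 / (1 + u y) ≤ e := by
      rw [div_le_iff₀ hs]
      have : (v y) ^ 2 ≤ p * 1 := by nlinarith
      nlinarith
    have k2 : (Q y - q) * (2 * (1 + u y) - v y) ^ 2 / (1 + u y) ≤ d * (4 * u y + 10) := by
      rw [div_le_iff₀ hs]
      have : (2 * (1 + u y) - v y) ^ 2 ≤ (4 * u y + 10) * (1 + u y) := by nlinarith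
      calc _ ≤ d * (2 * (1 + u y) - v y) ^ 2 := by
            gcongr; exact (le_abs_self _).trans h1
        _ ≤ d * ((4 * u y + 10) * (1 + u y)) := by gcongr
        _ = _ := by ring
    rw [add_div]
    nlinarith
  have hv : ∀ x, t ≤ x → x ≤ t + 1 → v x ≤ 0 := by
    refine nonpos_of_deriv_neg_of_eq_zero
      (fun y hy => h.hasDerivAt_v y (hT' y (ht.trans hy)).2.2) hneg ?_
    intro y hy hy1 hy0
    have := hder y hy hy1.le hy0.le
    linarith
  have hfin := sub_le_mul_of_deriv_le (g := v) (a := t) (b := t + 1)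
    (C := -e) (by linarith) (fun y hy => h.hasDerivAt_v y (hT' y (ht.trans hy)).2.2)
    (fun y hy hy1 => hder y hy hy1 (hv y hy hy1))
  have := (hT' (t + 1) (by linarith)).2.1
  linarith

/-- Once `u ≥ 2e`, `u` increases forever. The ratio `v/s` is then bounded below, so `s` grows
exponentially; yet `s = o(e^{2t})` forces `s` to be bounded. -/
theorem eventually_lt (h : IsPerturbedNode l u v Q T) {e : ℝ} (he : 0 < e) :
    ∀ᶠ t in atTop, u t < 2 * e := by
  have hl := h.two_lt
  set q := (l - 2) ^ 2 / 4 with hqdef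
  have hq : 0 < q := by have : 0 < l - 2 := by linarith
                        positivity
  have hl4 : 0 < l ^ 2 - 4 := by nlinarith
  obtain ⟨c, hc, hc2⟩ : ∃ c : ℝ, 0 < c ∧ 2 * c * (1 + 2 * e) = l ^ 2 * (2 * e) :=
    ⟨l ^ 2 * e / (1 + 2 * e), by positivity, by field_simp⟩
  obtain ⟨d, hd, hd1, hd2⟩ : ∃ d : ℝ, 0 < d ∧ d ≤ (l ^ 2 - 4) / 8 ∧ 4 * d ≤ c :=
    ⟨min ((l ^ 2 - 4) / 8) (c / 4), by positivity, min_le_left _ _, by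
      have := min_le_right ((l ^ 2 - 4) / 8) (c / 4); linarith⟩
  obtain ⟨T', hT'⟩ := ((h.eventually_abs_Q hd).and ((h.eventually_deriv_pos_of_le he).and
    ((h.tendsto_Q.eventually_const_lt hq).and
    (eventually_ge_atTop T)))).exists_forall_of_atTop
  filter_upwards [eventually_ge_atTop T'] with t ht
  by_contra! hut
  have hu : ∀ x, t ≤ x → 2 * e ≤ u x := by
    intro x hx
    have := nonpos_of_deriv_neg_of_eq_zero (g := fun y => 2 * e - u y) (g' := fun y => -v y)
      (a := t) (b := x) (fun y hy => by
        simpa using (h.hasDerivAt_u y (hT' y (ht.trans hy)).2.2.2).const_sub (2 * e))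
      (by linarith) (fun y hy _ hy0 => by
        have := (hT' y (ht.trans hy)).2.1 (by linarith)
        linarith) x hx le_rfl
    linarith
  have hv : ∀ x, t ≤ x → 0 < v x := fun x hx => (hT' x (ht.trans hx)).2.1 (hu x hx)
  have hs : ∀ x, t ≤ x → 0 < 1 + u x := fun x hx => h.one_add_pos x (hT' x (ht.trans hx)).2.2.2
  have hp : ∀ x, t ≤ x → 0 < v x / (1 + u x) := fun x hx => div_pos (hv x hx) (hs x hx)
  have hp2 : ∀ x, t ≤ x → v x / (1 + u x) < 2 := by
    intro x hx
    rw [div_lt_iff₀ (hs x hx)]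
    linarith [h.two_mul_sub_pos x (hT' x (ht.trans hx)).2.2.2]
  have hdp : ∀ x, t ≤ x → HasDerivAt (fun x => v x / (1 + u x))
      (-(l ^ 2 * u x) / (1 + u x) + 2 * l * (v x / (1 + u x)) + (q - 1) * (v x / (1 + u x)) ^ 2
        + (Q x - q) * (2 - v x / (1 + u x)) ^ 2) x := by
    intro x hx
    have h0 := (hs x hx).ne'
    have := (h.hasDerivAt_v x (hT' x (ht.trans hx)).2.2.2).fun_div
      ((h.hasDerivAt_u x (hT' x (ht.trans hx)).2.2.2).const_add 1) h0
    refine this.congr_deriv ?_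
    field_simp
    ring
  -- If `v/s` were below `c/(2l+2q)`, its own equation would drive it below `0`.
  have hlow := le_div_of_mul_sub_le_deriv_of_le (R := fun x => -(v x / (1 + u x)))
    (c := 2 * l + 2 * q) (d := -c) (T := t) (M := 0) (by positivity)
    (fun x hx => (hdp x hx).fun_neg) ?_ (fun x hx => by linarith [hp x hx])
  swap
  · intro x hx
    have hs' := hs x hx
    have k1 : -(l ^ 2 * u x) / (1 + u x) ≤ -(2 * c) := by
      rw [div_le_iff₀ hs']
      have := hu x hx
      have h2c : 2 * c ≤ l ^ 2 := by nlinarith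
      nlinarith
    have h1 := hp x hx
    have h2 := hp2 x hx
    set p := v x / (1 + u x) with hpdef
    have k2 : (Q x - q) * (2 - p) ^ 2 ≤ d * 4 := by
      calc _ ≤ d * (2 - p) ^ 2 := by
            gcongr; exact (le_abs_self _).trans (hT' x (ht.trans hx)).1
        _ ≤ d * 4 := by gcongr; nlinarith
    have k3 : (q - 1) * p ^ 2 ≤ 2 * q * p := by
      nlinarith [mul_nonneg (mul_pos hq h1).le (sub_nonneg.2 h2.le), sq_nonneg p]
    nlinarith
  -- This bounds `2s - v` by a constant: the equation of `2 - v/s` is unstable with rate at least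
  -- `(l²-4)/4` and source `l²/s`.
  have hAs := le_div_of_mul_sub_le_deriv_of_le
    (R := fun x => (l ^ 2 - 4) / 4 * (2 - v x / (1 + u x)) - l ^ 2 * (1 + u x)⁻¹)
    (c := (l ^ 2 - 4) / 4) (d := 0) (T := t) (M := (l ^ 2 - 4) / 4 * 2) (by positivity)
    (fun x hx => (((hdp x hx).const_sub 2).const_mul _).fun_sub
      ((((h.hasDerivAt_u x (hT' x (ht.trans hx)).2.2.2).const_add 1).fun_inv
        (hs x hx).ne').const_mul (l ^ 2))) ?_ ?_
  rotate_left
  · intro x hx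
    have hs' := hs x hx
    have h1 := hp x hx
    have h2 := hp2 x hx
    have hQ := (hT' x (ht.trans hx)).1
    have hQ0 := (hT' x (ht.trans hx)).2.2.1
    have e1 : -(l ^ 2 * u x) / (1 + u x) = -l ^ 2 + l ^ 2 * (1 + u x)⁻¹ := by
      field_simp; ring
    have e2 : l ^ 2 * (-v x / (1 + u x) ^ 2) = -(l ^ 2 * (1 + u x)⁻¹ * (v x / (1 + u x))) := by
      field_simp
    rw [e1, e2]
    have hB : 0 < l ^ 2 * (1 + u x)⁻¹ := by positivity
    set B := l ^ 2 * (1 + u x)⁻¹ with hBdef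
    set p := v x / (1 + u x) with hpdef
    have e3 : -l ^ 2 + B + 2 * l * p + (q - 1) * p ^ 2 + (Q x - q) * (2 - p) ^ 2
        = B - (2 - p) * (l ^ 2 - 2 * l - (Q x - 1) * (2 - p)) := by
      rw [hqdef]; ring
    rw [e3]
    have k1 : (l ^ 2 - 4) / 4 ≤ l ^ 2 - 2 * l - (Q x - 1) * (2 - p) := by
      have : Q x ≤ q + d := by have := (abs_le.1 hQ).2; linarith
      have : (Q x - 1) * (2 - p) ≤ 2 * (q + d) := by nlinarith
      have : 2 * q = l ^ 2 / 2 - 2 * l + 2 := by rw [hqdef]; ring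
      linarith
    have k2 : (2 - p) * ((l ^ 2 - 4) / 4)
        ≤ (2 - p) * (l ^ 2 - 2 * l - (Q x - 1) * (2 - p)) :=
      mul_le_mul_of_nonneg_left k1 (by linarith)
    have k3 : 0 < B * p := mul_pos hB h1
    nlinarith
  · intro x hx
    have hs' := hs x hx
    have h1 := hp x hx
    have hB : 0 < l ^ 2 * (1 + u x)⁻¹ := by positivity
    nlinarith
  -- Now `s' ≥ 2s - C`, and `s = o(e^{2t})` is exactly the growth condition for rate `2`.
  have hbdd := le_div_of_mul_sub_le_deriv (R := fun x => 1 + u x) (U := fun x => 1 + u x)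
    (c := 2) (d := 4 * l ^ 2 / (l ^ 2 - 4)) (T := t) two_pos
    (fun x hx => (h.hasDerivAt_u x (hT' x (ht.trans hx)).2.2.2).const_add 1) ?_
    (fun _ _ => le_rfl) h.tendsto_exp
  swap
  · intro x hx
    have hs' := hs x hx
    have k := hAs x hx
    simp only [zero_div] at k
    have k2 : (l ^ 2 - 4) / 4 * (2 * (1 + u x) - v x) ≤ l ^ 2 := by
      have : ((l ^ 2 - 4) / 4 * (2 - v x / (1 + u x)) - l ^ 2 * (1 + u x)⁻¹) * (1 + u x)
          = (l ^ 2 - 4) / 4 * (2 * (1 + u x) - v x) - l ^ 2 := by field_simp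
      nlinarith
    have k3 : 2 * (1 + u x) - v x ≤ 4 * l ^ 2 / (l ^ 2 - 4) := by
      rw [le_div_iff₀ hl4]; linarith
    linarith
  have hfin := le_div_of_mul_sub_le_deriv_of_le (R := fun x => 1 + u x)
    (c := c / (2 * l + 2 * q)) (d := 0) (T := t) (by positivity)
    (fun x hx => (h.hasDerivAt_u x (hT' x (ht.trans hx)).2.2.2).const_add 1) ?_ hbdd t le_rfl
  · rw [zero_div] at hfin
    linarith [hs t le_rfl]
  · intro x hx
    have hs' := hs x hx
    have k := hlow x hx
    have : c / (2 * l + 2 * q) ≤ v x / (1 + u x) := by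
      rw [neg_div] at k; linarith
    rw [le_div_iff₀ hs'] at this
    linarith

theorem tendsto_zero (h : IsPerturbedNode l u v Q T) : Tendsto u atTop (𝓝 0) := by
  rw [Metric.tendsto_nhds]
  intro e he
  filter_upwards [h.eventually_lt (half_pos he), h.eventually_neg_le (half_pos he)] with t h1 h2
  rw [Real.dist_0_eq_abs, abs_lt]
  constructor <;> linarith

theorem tendsto_deriv_zero (h : IsPerturbedNode l u v Q T) : Tendsto v atTop (𝓝 0) := by
  rw [Metric.tendsto_nhds]
  intro e he
  have h3 : ∀ᶠ t in atTop, l * u t < e / 2 := by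
    have := h.tendsto_zero.const_mul l
    rw [mul_zero] at this
    exact this.eventually_lt_const (half_pos he)
  filter_upwards [h.eventually_sub_le (half_pos he), h.eventually_neg_le_deriv (half_pos he),
    h3] with t h1 h2 h3
  rw [Real.dist_0_eq_abs, abs_lt]
  constructor <;> linarith

end IsPerturbedNode

/-! ### Rate of convergence -/

/-- The quadratic form `R = x² + m z²` satisfies `R' ≥ (l/2) R - δK` with `δ` arbitrarily small, and
grows more slowly than `e^{lt/2}`. -/
theorem tendsto_zero_of_unstable_node {l T : ℝ} (hl : 0 < l) {x z a b c d e : ℝ → ℝ}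
    (hx : ∀ t, T ≤ t → HasDerivAt x (l * x t + z t + (a t + b t * x t)) t)
    (hz : ∀ t, T ≤ t → HasDerivAt z (l * z t + (c t + d t * x t + e t * z t)) t)
    (ha : Tendsto a atTop (𝓝 0)) (hb : Tendsto b atTop (𝓝 0)) (hc : Tendsto c atTop (𝓝 0))
    (hd : Tendsto d atTop (𝓝 0)) (he : Tendsto e atTop (𝓝 0))
    (hxe : Tendsto (fun t => x t * Real.exp (-(l / 4) * t)) atTop (𝓝 0))
    (hze : Tendsto (fun t => z t * Real.exp (-(l / 4) * t)) atTop (𝓝 0)) :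
    Tendsto x atTop (𝓝 0) := by
  -- This weight lets `2 m l z² = 4z²/l` absorb the Jordan coupling `2xz ≥ -l x² - z²/l`.
  set m := 2 / l ^ 2 with hm
  have hmpos : 0 < m := by positivity
  set K := 6 * (1 + m) * (1 + 1 / m) with hK
  have hKpos : 0 < K := by positivity
  have hsq : ∀ δ : ℝ, 0 < δ → δ * K ≤ l / 2 → ∀ᶠ t in atTop, x t ^ 2 ≤ 2 * δ * K / l := by
    intro δ hδ hδK
    have small : ∀ {w : ℝ → ℝ}, Tendsto w atTop (𝓝 0) → ∀ᶠ t in atTop, |w t| ≤ δ := by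
      intro w hw
      have := hw.abs
      rw [abs_zero] at this
      exact this.eventually_le_const hδ
    obtain ⟨T', hT'⟩ := ((small ha).and ((small hb).and ((small hc).and ((small hd).and
      ((small he).and (eventually_ge_atTop T)))))).exists_forall_of_atTop
    have hmain := le_div_of_mul_sub_le_deriv (R := fun t => x t ^ 2 + m * z t ^ 2)
      (U := fun t => x t ^ 2 + m * z t ^ 2)
      (c := l / 2) (d := δ * K) (T := T') (by positivity)
      (fun t ht => ((hx t (hT' t ht).2.2.2.2.2).fun_pow 2).fun_add
        (((hz t (hT' t ht).2.2.2.2.2).fun_pow 2).const_mul m)) ?_ (fun _ _ => le_rfl) ?_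
    · filter_upwards [eventually_ge_atTop T'] with t ht
      have h1 := hmain t ht
      have h2 : δ * K / (l / 2) = 2 * δ * K / l := by field_simp
      have h3 : 0 ≤ m * z t ^ 2 := by positivity
      linarith
    · intro t ht
      obtain ⟨h1, h2, h3, h4, h5, h6⟩ := hT' t ht
      generalize x t = X at *
      generalize z t = Z at *
      set S := 1 + |X| + |Z| with hS
      have hX : |X| ≤ S := by rw [hS]; linarith [abs_nonneg Z]
      have hZ : |Z| ≤ S := by rw [hS]; linarith [abs_nonneg X]
      have hS0 : 0 ≤ S := (abs_nonneg X).trans hX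
      have k1 : |X * (a t + b t * X)| ≤ S * (δ * S) := by
        rw [abs_mul]
        refine mul_le_mul hX ?_ (abs_nonneg _) hS0
        calc |a t + b t * X| ≤ |a t| + |b t| * |X| := by
              rw [← abs_mul]; exact abs_add_le _ _
          _ ≤ δ + δ * |X| := by gcongr
          _ ≤ δ * S := by rw [hS]; nlinarith [abs_nonneg Z]
      have k2 : |Z * (c t + d t * X + e t * Z)| ≤ S * (δ * S) := by
        rw [abs_mul]
        refine mul_le_mul hZ ?_ (abs_nonneg _) hS0
        calc |c t + d t * X + e t * Z| ≤ |c t| + |d t| * |X| + |e t| * |Z| := by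
              rw [← abs_mul, ← abs_mul]; exact abs_add_three _ _ _
          _ ≤ δ + δ * |X| + δ * |Z| := by gcongr
          _ = δ * S := by rw [hS]; ring
      have k3 : S ^ 2 ≤ 3 * (1 + X ^ 2 + Z ^ 2) := by
        rw [hS, ← sq_abs X, ← sq_abs Z]
        nlinarith [sq_nonneg (|X| - |Z|), sq_nonneg (1 - |X|), sq_nonneg (1 - |Z|)]
      have k4 : 1 + X ^ 2 + Z ^ 2 ≤ (1 + 1 / m) * (1 + (X ^ 2 + m * Z ^ 2)) := by
        have : (1 + 1 / m) * (1 + (X ^ 2 + m * Z ^ 2)) = 1 + X ^ 2 + Z ^ 2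
          + (m * Z ^ 2 + 1 / m + 1 / m * X ^ 2) := by field_simp; ring
        rw [this]
        have : 0 ≤ m * Z ^ 2 + 1 / m + 1 / m * X ^ 2 := by positivity
        linarith
      have k5 : 2 * (1 + m) * (S * (δ * S)) ≤ δ * K * (1 + (X ^ 2 + m * Z ^ 2)) := by
        calc 2 * (1 + m) * (S * (δ * S)) = 2 * (1 + m) * δ * S ^ 2 := by ring
          _ ≤ 2 * (1 + m) * δ * (3 * ((1 + 1 / m) * (1 + (X ^ 2 + m * Z ^ 2)))) := by
            gcongr; linarith
          _ = _ := by rw [hK]; ring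
      have k6 : -(l * X ^ 2) - Z ^ 2 / l ≤ 2 * (X * Z) := by
        have : 2 * (X * Z) - (-(l * X ^ 2) - Z ^ 2 / l) = (l * X + Z) ^ 2 / l := by
          field_simp; ring
        have h0 : 0 ≤ (l * X + Z) ^ 2 / l := by positivity
        linarith
      have k7 : m * (2 * l * Z ^ 2) = 4 * (Z ^ 2 / l) := by rw [hm]; field_simp; ring
      have k8 : l * (m * Z ^ 2) = 2 * (Z ^ 2 / l) := by rw [hm]; field_simp
      have k9 : 0 ≤ Z ^ 2 / l := by positivity
      have k10 := (abs_le.1 k1).1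
      have k11 := mul_le_mul_of_nonneg_left (abs_le.1 k2).1 hmpos.le
      have k12 : δ * K * (X ^ 2 + m * Z ^ 2) ≤ l / 2 * (X ^ 2 + m * Z ^ 2) := by gcongr
      simp only [Nat.cast_ofNat, Nat.add_one_sub_one, pow_one]
      nlinarith
    · have := (hxe.pow 2).add ((hze.pow 2).const_mul m)
      simp only [ne_eq, OfNat.ofNat_ne_zero, not_false_eq_true, zero_pow, mul_zero, add_zero]
        at this
      refine this.congr fun t => ?_
      have : Real.exp (-(l / 2) * t) = Real.exp (-(l / 4) * t) ^ 2 := by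
        rw [← Real.exp_nat_mul]; congr 1; push_cast; ring
      rw [this]; ring
  rw [Metric.tendsto_nhds]
  intro r hr
  set δ := min (l / 2 / K) (r ^ 2 * l / (4 * K)) with hδ
  have hδpos : 0 < δ := by positivity
  have h1 : δ * K ≤ l / 2 := by
    calc δ * K ≤ l / 2 / K * K := by gcongr; exact min_le_left _ _
      _ = l / 2 := by field_simp
  have h2 : 2 * δ * K / l ≤ r ^ 2 / 2 := by
    calc 2 * δ * K / l ≤ 2 * (r ^ 2 * l / (4 * K)) * K / l := by gcongr; exact min_le_right _ _
      _ = r ^ 2 / 2 := by field_simp; ring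
  filter_upwards [hsq δ hδpos h1] with t ht
  rw [Real.dist_0_eq_abs]
  refine abs_lt_of_sq_lt_sq ?_ hr.le
  have : 0 < r ^ 2 := by positivity
  linarith

/-- Centre `t^k u` and `t^k (v - l u)` at their expected limits `4g/l²` and `-4g/l`. The factor
`t^k` costs only `k/t`, and `q v²/s` becomes linear with the vanishing coefficient `q v/s`, because
`t^k v = l x + z`. -/
theorem IsPerturbedNode.tendsto_rpow_mul {l : ℝ} {u v Q : ℝ → ℝ} {T k g : ℝ}
    (h : IsPerturbedNode l u v Q T)
    (hg : Tendsto (fun t => t ^ k * (Q t - (l - 2) ^ 2 / 4)) atTop (𝓝 g)) :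
    Tendsto (fun t => t ^ k * u t) atTop (𝓝 (4 * g / l ^ 2)) := by
  have hl := h.two_lt
  have hl0 : 0 < l := by linarith
  have hu := h.tendsto_zero
  have hv := h.tendsto_deriv_zero
  set q := (l - 2) ^ 2 / 4 with hq
  have hs : Tendsto (fun t => 1 + u t) atTop (𝓝 1) := by simpa using hu.const_add 1
  have hexp : Tendsto (fun t : ℝ => Real.exp (-(l / 4) * t)) atTop (𝓝 0) :=
    Real.tendsto_exp_atBot.comp (tendsto_id.const_mul_atTop_of_neg (by linarith))
  have hpow : Tendsto (fun t : ℝ => t ^ k * Real.exp (-(l / 4) * t)) atTop (𝓝 0) :=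
    tendsto_rpow_mul_exp_neg_mul_atTop_nhds_zero k (l / 4) (by positivity)
  have hkt : Tendsto (fun t : ℝ => k / t) atTop (𝓝 0) := tendsto_const_nhds.div_atTop tendsto_id
  have hqv : Tendsto (fun t => q * v t / (1 + u t)) atTop (𝓝 0) := by
    have := (hv.const_mul q).div hs one_ne_zero
    simp only [mul_zero, zero_div] at this
    exact this
  have hdpow : ∀ t : ℝ, 0 < t → HasDerivAt (fun t : ℝ => t ^ k) (k / t * t ^ k) t := by
    intro t ht
    refine (Real.hasDerivAt_rpow_const (Or.inl ht.ne')).congr_deriv ?_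
    rw [Real.rpow_sub_one ht.ne']; ring
  have key : Tendsto (fun t => t ^ k * u t - 4 * g / l ^ 2) atTop (𝓝 0) := by
    refine tendsto_zero_of_unstable_node (l := l) (T := max T 1) hl0
      (x := fun t => t ^ k * u t - 4 * g / l ^ 2)
      (z := fun t => t ^ k * (v t - l * u t) + 4 * g / l)
      (a := fun t => k / t * (4 * g / l ^ 2)) (b := fun t => k / t)
      (c := fun t => -(k / t * (4 * g / l)) +
        (t ^ k * (Q t - q) * ((2 * (1 + u t) - v t) ^ 2 / (1 + u t)) - 4 * g))
      (d := fun t => l * (q * v t / (1 + u t))) (e := fun t => k / t + q * v t / (1 + u t))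
      ?_ ?_ ?_ hkt ?_ ?_ ?_ ?_ ?_
    · intro t ht
      have h1 : T ≤ t := (le_max_left _ _).trans ht
      have h2 : 0 < t := zero_lt_one.trans_le ((le_max_right _ _).trans ht)
      refine (((hdpow t h2).mul (h.hasDerivAt_u t h1)).sub_const _).congr_deriv ?_
      field_simp; ring
    · intro t ht
      have h1 : T ≤ t := (le_max_left _ _).trans ht
      have h2 : 0 < t := zero_lt_one.trans_le ((le_max_right _ _).trans ht)
      have h3 := h.one_add_pos t h1
      refine (((hdpow t h2).mul ((h.hasDerivAt_v t h1).sub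
        ((h.hasDerivAt_u t h1).const_mul l))).add_const _).congr_deriv ?_
      simp only [Pi.sub_apply]
      generalize t ^ k = p
      rw [← hq]
      generalize q = q'
      generalize Q t = Q'
      field_simp; ring
    · simpa using hkt.mul_const (4 * g / l ^ 2)
    · have h1 : Tendsto (fun t => (2 * (1 + u t) - v t) ^ 2 / (1 + u t)) atTop (𝓝 4) := by
        have := (((hs.const_mul 2).sub hv).pow 2).div hs one_ne_zero
        norm_num at this
        exact this
      have h2 := (hkt.mul_const (4 * g / l)).neg.add ((hg.mul h1).sub_const (4 * g))
      have h3 : -(0 * (4 * g / l)) + (g * 4 - 4 * g) = 0 := by ring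
      rw [h3] at h2
      exact h2
    · simpa using hqv.const_mul l
    · simpa using hkt.add hqv
    · have := (hpow.mul hu).sub (hexp.const_mul (4 * g / l ^ 2))
      simp only [mul_zero, sub_zero] at this
      exact this.congr fun t => by ring
    · have := (hpow.mul (hv.sub (hu.const_mul l))).add (hexp.const_mul (4 * g / l))
      simp only [mul_zero, sub_zero, add_zero] at this
      exact this.congr fun t => by ring
  have hfin := key.add_const (4 * g / l ^ 2)
  rw [zero_add] at hfin
  exact hfin.congr fun t => by ring

/-! ### The tail integral -/

theorem tailIntegral_eq_sub {f : ℝ → ℝ} (h : IntegrableOn (fun s => 1 / f s) (Ioi 0)) {x : ℝ}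
    (hx : 0 ≤ x) : tailIntegral f x = tailIntegral f 0 - ∫ s in (0 : ℝ)..x, 1 / f s := by
  have := intervalIntegral.integral_interval_add_Ioi h (h.mono_set (Ioi_subset_Ioi hx))
  unfold tailIntegral
  linarith

theorem hasDerivAt_tailIntegral {f : ℝ → ℝ} (hf : CondSmoothPos f)
    (h : IntegrableOn (fun s => 1 / f s) (Ioi 0)) {x : ℝ} (hx : 0 < x) :
    HasDerivAt (tailIntegral f) (-(1 / f x)) x := by
  have hcont : ContinuousOn (fun s => 1 / f s) (Ici 0) :=
    continuousOn_const.div hf.contDiffOn.continuousOn fun s hs => (hf.pos s hs).ne'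
  have hint : HasDerivAt (fun x => ∫ s in (0 : ℝ)..x, 1 / f s) (1 / f x) x := by
    refine intervalIntegral.integral_hasDerivAt_right ?_ ?_ (hcont.continuousAt (Ici_mem_nhds hx))
    · exact (hcont.mono (by rw [uIcc_of_le hx.le]; exact Icc_subset_Ici_self)).intervalIntegrable
    · exact (hcont.mono Ioi_subset_Ici_self).stronglyMeasurableAtFilter isOpen_Ioi x hx
  refine (hint.const_sub (tailIntegral f 0)).congr_of_eventuallyEq ?_
  filter_upwards [Ioi_mem_nhds hx] with y hy
  exact tailIntegral_eq_sub h (le_of_lt hy)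

theorem tailIntegral_pos {f : ℝ → ℝ} (hf : CondSmoothPos f)
    (h : IntegrableOn (fun s => 1 / f s) (Ioi 0)) {x : ℝ} (hx : 0 ≤ x) : 0 < tailIntegral f x := by
  have hcont : ContinuousOn (fun s => 1 / f s) (Ici 0) :=
    continuousOn_const.div hf.contDiffOn.continuousOn fun s hs => (hf.pos s hs).ne'
  have h1 := intervalIntegral.integral_interval_add_Ioi (b := x + 1)
    (h.mono_set (Ioi_subset_Ioi hx)) (h.mono_set (Ioi_subset_Ioi (by linarith)))
  have h2 : 0 < ∫ s in x..(x + 1), 1 / f s := by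
    refine intervalIntegral.intervalIntegral_pos_of_pos_on ?_ ?_ (by linarith)
    · refine (hcont.mono ?_).intervalIntegrable
      rw [uIcc_of_le (by linarith)]
      exact fun s hs => hx.trans hs.1
    · intro s hs
      exact one_div_pos.2 (hf.pos s (hx.trans hs.1.le))
  have h3 : 0 ≤ ∫ s in Ioi (x + 1), 1 / f s := by
    refine setIntegral_nonneg measurableSet_Ioi fun s hs => ?_
    have hs' : x + 1 < s := hs
    exact (one_div_pos.2 (hf.pos s (by linarith))).le
  unfold tailIntegral
  linarith

theorem tendsto_tailIntegral_atTop {f : ℝ → ℝ} (h : IntegrableOn (fun s => 1 / f s) (Ioi 0)) :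
    Tendsto (tailIntegral f) atTop (𝓝 0) := by
  have h1 := (intervalIntegral_tendsto_integral_Ioi 0 h tendsto_id).const_sub (tailIntegral f 0)
  have h2 : tailIntegral f 0 - ∫ s in Ioi (0 : ℝ), 1 / f s = 0 := sub_self _
  rw [h2] at h1
  refine h1.congr' ?_
  filter_upwards [eventually_ge_atTop 0] with x hx
  exact (tailIntegral_eq_sub h hx).symm

theorem CondSmoothPos.hasDerivAt {f : ℝ → ℝ} (hf : CondSmoothPos f) {x : ℝ} (hx : 0 < x) :
    HasDerivAt f (deriv f x) x :=
  ((hf.contDiffOn.contDiffAt (Ici_mem_nhds hx)).differentiableAt two_ne_zero).hasDerivAt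

/-! ### Radial singular solutions -/

namespace IsRadialSingularSolution

variable {N : ℕ} {f V : ℝ → ℝ}

theorem hasDerivAt (hV : IsRadialSingularSolution N f V) {r : ℝ} (hr : 0 < r) :
    HasDerivAt V (deriv V r) r :=
  ((hV.contDiffOn.contDiffAt (Ioi_mem_nhds hr)).differentiableAt two_ne_zero).hasDerivAt

theorem hasDerivAt_deriv (hV : IsRadialSingularSolution N f V) {r : ℝ} (hr : 0 < r) :
    HasDerivAt (deriv V) (-((N : ℝ) - 1) / r * deriv V r - f (V r)) r := by
  have h1 : ContDiffOn ℝ 1 (deriv V) (Ioi 0) :=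
    hV.contDiffOn.deriv_of_isOpen isOpen_Ioi (by norm_num)
  have h2 := ((h1.contDiffAt (Ioi_mem_nhds hr)).differentiableAt one_ne_zero).hasDerivAt
  refine h2.congr_deriv ?_
  have := hV.equation r hr
  unfold radialLaplacian at this
  linear_combination -this

/-- `r^{N-1} V'` is strictly decreasing near `0`. A point with `V' ≥ 0` would make `V` increasing to
its left, against `V → ∞`. -/
theorem eventually_deriv_neg (hV : IsRadialSingularSolution N f V) (hN : 1 ≤ N)
    (hf : ∀ u, 0 ≤ u → 0 < f u) : ∀ᶠ r in 𝓝[>] (0 : ℝ), deriv V r < 0 := by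
  obtain ⟨n, rfl⟩ : ∃ n, N = n + 1 := ⟨N - 1, by omega⟩
  obtain ⟨r₀, hr₀, hpos⟩ := mem_nhdsGT_iff_exists_Ioo_subset.1
    (hV.singular.eventually_ge_atTop 0)
  have hr₀' : 0 < r₀ := hr₀
  have hder : ∀ r, 0 < r →
      HasDerivAt (fun r => r ^ n * deriv V r) (-(r ^ n * f (V r))) r := by
    intro r hr
    refine ((hasDerivAt_pow n r).mul (hV.hasDerivAt_deriv hr)).congr_deriv ?_
    rcases n with _ | n
    · simp
    · push_cast
      simp only [add_tsub_cancel_right]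
      field_simp
      ring
  have hanti : StrictAntiOn (fun r => r ^ n * deriv V r) (Ioo 0 r₀) := by
    refine strictAntiOn_of_deriv_neg (convex_Ioo 0 r₀)
      (fun r hr => (hder r hr.1).continuousAt.continuousWithinAt) fun r hr => ?_
    rw [interior_Ioo] at hr
    rw [(hder r hr.1).deriv]
    have h1 := hf _ (hpos hr)
    have h2 : 0 < r ^ n := pow_pos hr.1 n
    have := mul_pos h2 h1
    linarith
  filter_upwards [Ioo_mem_nhdsGT hr₀'] with r hr
  by_contra! hneg
  have hV' : ∀ x, x ∈ Ioo 0 r → 0 < deriv V x := by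
    intro x hx
    have h1 := hanti (show x ∈ Ioo 0 r₀ from ⟨hx.1, hx.2.trans hr.2⟩) hr hx.2
    have h2 : 0 ≤ r ^ n * deriv V r := mul_nonneg (pow_pos hr.1 n).le hneg
    exact pos_of_mul_pos_right (h2.trans_lt h1) (pow_pos hx.1 n).le
  have hmono : MonotoneOn V (Ioc 0 r) := by
    refine monotoneOn_of_deriv_nonneg (convex_Ioc 0 r)
      (fun x hx => (hV.hasDerivAt hx.1).continuousAt.continuousWithinAt)
      (fun x hx => ?_) (fun x hx => ?_)
    · rw [interior_Ioc] at hx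
      exact (hV.hasDerivAt hx.1).differentiableAt.differentiableWithinAt
    · rw [interior_Ioc] at hx
      exact (hV' x hx).le
  obtain ⟨x, hx1, hx2⟩ := ((hV.singular.eventually_gt_atTop (V r)).and
    (Ioo_mem_nhdsGT hr.1)).exists
  exact absurd (hmono ⟨hx2.1, hx2.2.le⟩ ⟨hr.1, le_rfl⟩ hx2.2.le) (not_le.2 hx1)

end IsRadialSingularSolution

/-! ### Reduction to the perturbed node -/

theorem tendsto_exp_neg_nhdsGT_zero : Tendsto (fun t : ℝ => Real.exp (-t)) atTop (𝓝[>] 0) :=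
  Real.tendsto_exp_atBot_nhdsGT.comp tendsto_neg_atTop_atBot

/-- The weight `(-log F)^k` tends to infinity, since `F → 0+` and `k > 0`. -/
theorem CondRefined.tendsto {N : ℕ} {f : ℝ → ℝ} {k γ : ℝ} (hk : 0 < k) (hf : CondSmoothPos f)
    (hint : IntegrableOn (fun s => 1 / f s) (Ioi 0)) (h : CondRefined N f k γ) :
    Tendsto (fun u => tailIntegral f u * deriv f u) atTop (𝓝 (qJL N)) := by
  have hF : Tendsto (tailIntegral f) atTop (𝓝[>] 0) := by
    refine tendsto_nhdsWithin_iff.2 ⟨tendsto_tailIntegral_atTop hint, ?_⟩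
    filter_upwards [eventually_ge_atTop 0] with u hu
    exact tailIntegral_pos hf hint hu
  have hlog : Tendsto (fun u => (-Real.log (tailIntegral f u)) ^ k) atTop atTop :=
    (tendsto_rpow_atTop hk).comp (tendsto_neg_atBot_atTop.comp
      (Real.tendsto_log_nhdsGT_zero.comp hF))
  have h1 := (h.div_atTop hlog).add_const (qJL N)
  rw [zero_add] at h1
  refine h1.congr' ?_
  filter_upwards [hlog.eventually_gt_atTop 0] with u hu
  field_simp
  ring

theorem qJL_eq {N : ℕ} (hN : 1 ≤ N) : qJL N = (√((N : ℝ) - 1) + 1 - 2) ^ 2 / 4 := by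
  have h1 : (1 : ℝ) ≤ N := by exact_mod_cast hN
  have := Real.sq_sqrt (show 0 ≤ (N : ℝ) - 1 by linarith)
  unfold qJL
  linear_combination -(1 / 4) * this

/-- In the variable `t = -log r`, the function `F (V r) / r ^ 2`, suitably normalised, solves a
perturbation of an autonomous system with an unstable node. -/
theorem IsRadialSingularSolution.isPerturbedNode {N : ℕ} (hN : 3 ≤ N) {f V : ℝ → ℝ}
    (hf : CondSmoothPos f) (hint : IntegrableOn (fun s => 1 / f s) (Ioi 0))
    (hq : Tendsto (fun u => tailIntegral f u * deriv f u) atTop (𝓝 (qJL N)))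
    (hV : IsRadialSingularSolution N f V) {l : ℝ} (hl : l = √((N : ℝ) - 1) + 1) :
    ∃ v T, IsPerturbedNode l
      (fun t => l ^ 2 * Real.exp t ^ 2 * tailIntegral f (V (Real.exp (-t))) - 1) v
      (fun t => tailIntegral f (V (Real.exp (-t))) * deriv f (V (Real.exp (-t)))) T := by
  have hN' : (3 : ℝ) ≤ N := by exact_mod_cast hN
  have hsq := Real.sq_sqrt (show 0 ≤ (N : ℝ) - 1 by linarith)
  have hl2 : 2 < l := by
    have : (1 : ℝ) < √((N : ℝ) - 1) := by
      rw [Real.lt_sqrt zero_le_one]; linarith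
    linarith
  have hNl : (N : ℝ) = (l - 1) ^ 2 + 1 := by rw [hl]; linear_combination -hsq
  have hVt : Tendsto (fun t => V (Real.exp (-t))) atTop atTop :=
    hV.singular.comp tendsto_exp_neg_nhdsGT_zero
  obtain ⟨T, hT⟩ := ((hVt.eventually_gt_atTop 0).and
    (tendsto_exp_neg_nhdsGT_zero.eventually
      (hV.eventually_deriv_neg (by omega) hf.pos))).exists_forall_of_atTop
  have hexp : ∀ t : ℝ, HasDerivAt (fun t : ℝ => Real.exp (-t)) (-Real.exp (-t)) t := by
    intro t
    simpa using (hasDerivAt_neg t).exp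
  have hee : ∀ t : ℝ, Real.exp (-t) = (Real.exp t)⁻¹ := Real.exp_neg
  have hdV : ∀ t : ℝ, HasDerivAt (fun t => V (Real.exp (-t)))
      (deriv V (Real.exp (-t)) * -Real.exp (-t)) t := fun t =>
    (hV.hasDerivAt (Real.exp_pos (-t))).comp t (hexp t)
  have hdV' : ∀ t : ℝ, HasDerivAt (fun t => deriv V (Real.exp (-t)))
      ((-((N : ℝ) - 1) / Real.exp (-t) * deriv V (Real.exp (-t)) - f (V (Real.exp (-t))))
        * -Real.exp (-t)) t := fun t =>
    (hV.hasDerivAt_deriv (Real.exp_pos (-t))).comp (h₂ := deriv V) t (hexp t)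
  have hdf : ∀ t, T ≤ t → HasDerivAt (fun t => f (V (Real.exp (-t))))
      (deriv f (V (Real.exp (-t))) * (deriv V (Real.exp (-t)) * -Real.exp (-t))) t :=
    fun t ht => (hf.hasDerivAt (hT t ht).1).comp t (hdV t)
  have hdF : ∀ t, T ≤ t → HasDerivAt (fun t => tailIntegral f (V (Real.exp (-t))))
      (-(1 / f (V (Real.exp (-t)))) * (deriv V (Real.exp (-t)) * -Real.exp (-t))) t :=
    fun t ht => (hasDerivAt_tailIntegral hf hint (hT t ht).1).comp (h₂ := tailIntegral f) t (hdV t)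
  have hds : ∀ t, T ≤ t → HasDerivAt
      (fun t => l ^ 2 * Real.exp t ^ 2 * tailIntegral f (V (Real.exp (-t))) - 1)
      (2 * (l ^ 2 * Real.exp t ^ 2 * tailIntegral f (V (Real.exp (-t))))
        + l ^ 2 * Real.exp t * deriv V (Real.exp (-t)) / f (V (Real.exp (-t)))) t := by
    intro t ht
    have h0 := (hf.pos _ (hT t ht).1.le).ne'
    refine (((((Real.hasDerivAt_exp t).fun_pow 2).const_mul (l ^ 2)).fun_mul
      (hdF t ht)).sub_const 1).congr_deriv ?_
    rw [hee]
    generalize V (Real.exp t)⁻¹ = y at *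
    rw [hee] at h0
    have := Real.exp_pos t
    generalize Real.exp t = E at *
    push_cast
    field_simp
  refine ⟨fun t => 2 * (l ^ 2 * Real.exp t ^ 2 * tailIntegral f (V (Real.exp (-t))))
        + l ^ 2 * Real.exp t * deriv V (Real.exp (-t)) / f (V (Real.exp (-t))), T, hl2, hds,
        ?_, ?_, ?_, ?_, ?_⟩
  · intro t ht
    have h0 := hf.pos _ (hT t ht).1.le
    have hF := tailIntegral_pos hf hint (hT t ht).1.le
    refine ((((hds t ht).add_const 1).const_mul 2).congr_of_eventuallyEq ?_ |>.fun_add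
      ((((Real.hasDerivAt_exp t).const_mul (l ^ 2)).fun_mul (hdV' t)).fun_div (hdf t ht)
        h0.ne')).congr_deriv ?_
    · exact Eventually.of_forall fun x => by simp
    · simp only [add_sub_cancel]
      rw [hNl]
      have hE := Real.exp_pos t
      rw [hee] at *
      generalize V (Real.exp t)⁻¹ = y at *
      generalize deriv V (Real.exp t)⁻¹ = y' at *
      generalize Real.exp t = E at *
      generalize f y = fy at *
      generalize tailIntegral f y = F at *
      generalize deriv f y = f' at *
      have : l ≠ 0 := by linarith
      field_simp
      ring
  · intro t ht
    have hF := tailIntegral_pos hf hint (hT t ht).1.le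
    have : 0 < l ^ 2 * Real.exp t ^ 2 * tailIntegral f (V (Real.exp (-t))) := by positivity
    linarith
  · intro t ht
    have h0 := hf.pos _ (hT t ht).1.le
    have h1 := (hT t ht).2
    have : l ^ 2 * Real.exp t * deriv V (Real.exp (-t)) / f (V (Real.exp (-t))) < 0 :=
      div_neg_of_neg_of_pos (mul_neg_of_pos_of_neg (by positivity) h1) h0
    linarith
  · rw [qJL_eq (by omega), ← hl] at hq
    exact hq.comp hVt
  · have := ((tendsto_tailIntegral_atTop hint).comp hVt).const_mul (l ^ 2)
    rw [mul_zero] at this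
    refine this.congr fun t => ?_
    have h2 : Real.exp (-2 * t) = (Real.exp t ^ 2)⁻¹ := by
      rw [← Real.exp_nat_mul, ← Real.exp_neg]; congr 1; push_cast; ring
    have := Real.exp_pos t
    rw [h2]
    simp only [Function.comp]
    field_simp
    ring

/-! ### Asymptotics of `f'(V)` -/

theorem theorem3p3 (N : ℕ) (hN : 3 ≤ N) (f : ℝ → ℝ) (k γ : ℝ)
    (hk : 0 < k) (hk' : k ≤ 2)
    (hf1 : CondSmoothPos f) (hf2 : CondSupercritical N f) (hF1 : CondRefined N f k γ)
    (V : ℝ → ℝ) (hV : IsRadialSingularSolution N f V) :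
    ∃ ε : ℝ → ℝ, Tendsto ε (𝓝[>] 0) (𝓝 0) ∧
      ∀ᶠ r in 𝓝[>] (0 : ℝ),
        deriv f (V r) = ((N : ℝ) - 2) ^ 2 / (4 * r ^ 2) +
          (γ * √((N : ℝ) - 1) + ε r) /
            ((2 : ℝ) ^ (k - 2) * r ^ 2 * (-Real.log r) ^ k) := by
  have hint := hf2.integrable
  obtain ⟨l, hl⟩ : ∃ l, l = √((N : ℝ) - 1) + 1 := ⟨_, rfl⟩
  obtain ⟨v, T, h⟩ := hV.isPerturbedNode hN hf1 hint (hF1.tendsto hk hf1 hint) hl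
  have hN' : (3 : ℝ) ≤ N := by exact_mod_cast hN
  have hsq := Real.sq_sqrt (show 0 ≤ (N : ℝ) - 1 by linarith)
  have hsqrt : √((N : ℝ) - 1) = l - 1 := by rw [hl]; ring
  have hNl : (N : ℝ) = (l - 1) ^ 2 + 1 := by rw [← hsqrt]; linear_combination -hsq
  have hqJL : qJL N = (l - 2) ^ 2 / 4 := by rw [qJL_eq (by omega), ← hl]
  have hl0 : 0 < l := by linarith [h.two_lt]
  have hVt : Tendsto (fun t => V (Real.exp (-t))) atTop atTop :=
    hV.singular.comp tendsto_exp_neg_nhdsGT_zero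
  set u := fun t => l ^ 2 * Real.exp t ^ 2 * tailIntegral f (V (Real.exp (-t))) - 1 with hu
  set Q := fun t => tailIntegral f (V (Real.exp (-t))) * deriv f (V (Real.exp (-t))) with hQ
  have hu0 := h.tendsto_zero
  have hs : Tendsto (fun t => 1 + u t) atTop (𝓝 1) := by simpa using hu0.const_add 1
  -- Take logarithms in `F(V) = (1 + u) e^{-2t} / l²`.
  have hlog : Tendsto (fun t => -Real.log (tailIntegral f (V (Real.exp (-t)))) / t)
      atTop (𝓝 2) := by
    have h1 : Tendsto (fun t => 2 + (2 * Real.log l - Real.log (1 + u t)) / t) atTop (𝓝 (2 + 0)) :=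
      (((hs.log one_ne_zero).const_sub (2 * Real.log l)).div_atTop tendsto_id).const_add 2
    rw [add_zero] at h1
    refine h1.congr' ?_
    filter_upwards [eventually_gt_atTop 0, hVt.eventually_ge_atTop 0] with t ht hV0
    have hF := tailIntegral_pos hf1 hint hV0
    have : 1 + u t = l ^ 2 * Real.exp t ^ 2 * tailIntegral f (V (Real.exp (-t))) := by
      rw [hu]; ring
    rw [this, Real.log_mul (by positivity) hF.ne', Real.log_mul (by positivity) (by positivity),
      Real.log_pow, Real.log_pow, Real.log_exp]
    push_cast
    field_simp
    ring
  have hg : Tendsto (fun t => t ^ k * (Q t - (l - 2) ^ 2 / 4)) atTop (𝓝 (γ / 2 ^ k)) := by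
    have h1 := (hF1.comp hVt).div (hlog.rpow_const (p := k) (Or.inl two_ne_zero))
      (by positivity)
    refine h1.congr' ?_
    filter_upwards [eventually_gt_atTop 0, hlog.eventually_const_lt two_pos] with t ht hpos
    have h2 : 0 < -Real.log (tailIntegral f (V (Real.exp (-t)))) := by
      have := mul_pos hpos ht
      rwa [div_mul_cancel₀ _ ht.ne'] at this
    simp only [Pi.div_apply, Function.comp]
    rw [Real.div_rpow h2.le ht.le, ← hqJL]
    have h3 := Real.rpow_pos_of_pos h2 k
    have h4 := Real.rpow_pos_of_pos ht k
    field_simp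
    rfl
  have hX := h.tendsto_rpow_mul hg
  have hpow : (2 : ℝ) ^ (k - 2) = 2 ^ k / 4 := by
    rw [Real.rpow_sub two_pos]; norm_num
  have h2k : (0 : ℝ) < 2 ^ k := by positivity
  -- With `q = (l-2)²/4` and `N - 2 = l(l-2)`, the remainder is `f'(V) - (N-2)²/(4r²) = (l²/r²)(Q -
  -- q - q u)/(1 + u)`. Its limit uses `l² - (l-2)² = 4(l-1)`.
  have hE : Tendsto (fun t => l ^ 2 * 2 ^ (k - 2) * ((t ^ k * (Q t - (l - 2) ^ 2 / 4)
      - (l - 2) ^ 2 / 4 * (t ^ k * u t)) / (1 + u t)) - γ * (l - 1)) atTop (𝓝 0) := by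
    have := (((hg.sub (hX.const_mul ((l - 2) ^ 2 / 4))).div hs one_ne_zero).const_mul
      (l ^ 2 * 2 ^ (k - 2))).sub_const (γ * (l - 1))
    have h0 : l ^ 2 * 2 ^ (k - 2) * ((γ / 2 ^ k - (l - 2) ^ 2 / 4 * (4 * (γ / 2 ^ k) / l ^ 2)) / 1)
        - γ * (l - 1) = 0 := by
      rw [hpow]; field_simp; ring
    rw [h0] at this
    exact this
  have hlogr : Tendsto (fun r => -Real.log r) (𝓝[>] 0) atTop :=
    tendsto_neg_atBot_atTop.comp Real.tendsto_log_nhdsGT_zero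
  refine ⟨_, hE.comp hlogr, ?_⟩
  filter_upwards [hlogr.eventually_gt_atTop 0, hlogr.eventually_ge_atTop T, self_mem_nhdsWithin]
    with r hr hrT hr0
  have hr0' : 0 < r := hr0
  have hs0 := h.one_add_pos _ hrT
  have e1 : Real.exp (- -Real.log r) = r := by rw [neg_neg, Real.exp_log hr0']
  have e2 : Real.exp (-Real.log r) = r⁻¹ := by rw [Real.exp_neg, Real.exp_log hr0']
  have hst : 1 + u (-Real.log r) = l ^ 2 * tailIntegral f (V r) / r ^ 2 := by
    simp only [hu, e1, e2]; field_simp; ring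
  have hQt : Q (-Real.log r) = tailIntegral f (V r) * deriv f (V r) := by
    simp only [hQ, e1]
  have hut : u (-Real.log r) = l ^ 2 * tailIntegral f (V r) / r ^ 2 - 1 := by linarith
  have hF : tailIntegral f (V r) ≠ 0 := by
    rintro h0
    rw [hst, h0] at hs0
    simp at hs0
  simp only [Function.comp]
  rw [hst, hQt, hut, hsqrt, hNl, hpow]
  have hrk := Real.rpow_pos_of_pos hr k
  generalize (-Real.log r) ^ k = p at *
  generalize tailIntegral f (V r) = F at *
  generalize deriv f (V r) = D at *
  field_simp
  ring
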